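/- We work in the deterministic $\mathsf{CONGEST}$ model. The input graph $G=(V,E)$ is a finite connected simple graph with $n=|V|$ nodes, which is also the communication network. Nodes have distinct identifiers in $\{0,\dots,N-1\}$, where $N\le n^{c}$ for a constant $c$; initially each node knows only $N$, its own identifier and its degree (the number of its incident edges, which it distinguishes by locally numbered ports; the numbering is arbitrary), and all nodes know the pattern graph $H$. Computation proceeds in synchronous rounds; in each round every node may send a possibly different message of $O(\log n)$ bits along each of its edges, receives the messages of its neighbours, and performs unrestricted local computation. Each node eventually halts with a local output. The number of rounds is counted until all nodes have halted. The vertex cover number $\tau(G)$ is the minimum size of a set of nodes that meets every edge of $G$. \textbf{Theorem.} There is an absolute constant $C$ such that for every constant $c$ there is a constant $b$ with the following property. For every finite simple graph $H$ with node set $V_H$ and $k=|V_H|$, there is a deterministic $\mathsf{CONGEST}$ algorithm with messages of at most $b\lceil\log_2 n\rceil$ bits which, on every finite connected graph $G$ with $n$ nodes, every assignment of distinct identifiers in $\{0,\dots,N-1\}$ with $N\le n^{c}$, and every port numbering, halts within $$2^{\,C(\tau(G)+k)^2}$$ rounds (independently of $n$, and without $\tau(G)$ being given to the nodes) and solves induced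 $H$-detection, including finding a copy: every node reports whether $G$ contains $H$ as an induced subgraph, and moreover every node $v$ outputs $f(v)\in V_H\cup\{\bot\}$ such that, if $G$ contains an induced copy of $H$, then $f$ restricted to $U=\{v: f(v)\neq\bot\}$ is an isomorphism from $G[U]$ onto $H$, and otherwise $f(v)=\bot$ for all $v$. -/

import Mathlib

universe u v

/-- A deterministic algorithm for the `CONGEST` model: one and the same program is run by all nodes.
Local computation is unrestricted, messages are bit strings (the empty string means silence).
A node starts with a bound on the identifiers, its own identifier and its degree. In particular it
does not know the identifiers of its neighbours. -/
structure CongestAlgorithm (Out : Type u) where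
  /-- local states of a node -/
  State : Type u
  /-- initial state, from the identifier bound, the own identifier and the own degree -/
  init : (idBound id degree : ℕ) → State
  /-- the message sent through the port with the given number -/
  send : State → ℕ → List Bool
  /-- new state from the old one and the messages received in this round, listed by port -/
  receive : State → List (List Bool) → State
  /-- `some o` when the node has halted with local output `o`, `none` while it is running -/
  output : State → Option Out

/-- A communication network: a graph on the node set `V`, distinct identifiers in
`{0, …, idBound - 1}`, and at each node a numbering of its incident edges by ports
`0, …, deg - 1`. -/
structure CongestNetwork (V : Type v) where
  graph : SimpleGraph V
  idBound : ℕ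
  id : V ↪ Fin idBound
  deg : V → ℕ
  port : (x : V) → Fin (deg x) ≃ graph.neighborSet x

namespace CongestNetwork

variable {V : Type v} {Out : Type u}

/-- The message that node `x` in global state `s` sends through port `i`; a halted node is silent. -/
def message (N : CongestNetwork V) (A : CongestAlgorithm Out) (s : V → A.State)
    (x : V) (i : Fin (N.deg x)) : List Bool :=
  if (A.output (s x)).isSome then [] else A.send (s x) i

/-- The port of the neighbour `y` reached from `x` through port `i` that leads back to `x`. -/
def backPort (N : CongestNetwork V) (x : V) (i : Fin (N.deg x)) :
    Fin (N.deg (N.port x i : V)) :=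
  (N.port (N.port x i : V)).symm ⟨x, SimpleGraph.Adj.symm (N.port x i).2⟩

/-- The messages arriving at node `x`, listed by the ports of `x`. -/
def inbox (N : CongestNetwork V) (A : CongestAlgorithm Out) (s : V → A.State) (x : V) :
    List (List Bool) :=
  List.ofFn fun i : Fin (N.deg x) => N.message A s (N.port x i : V) (N.backPort x i)

/-- The global state after `t` synchronous rounds; a node that has halted keeps its state. -/
def run (N : CongestNetwork V) (A : CongestAlgorithm Out) : ℕ → V → A.State
  | 0 => fun x => A.init N.idBound (N.id x) (N.deg x)
  | t + 1 => fun x =>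
      if (A.output (N.run A t x)).isSome then N.run A t x
      else A.receive (N.run A t x) (N.inbox A (N.run A t) x)

/-- In every round, every message sent along an edge has at most `B` bits. -/
def RespectsBandwidth (N : CongestNetwork V) (A : CongestAlgorithm Out) (B : ℕ) : Prop :=
  ∀ (t : ℕ) (x : V) (i : Fin (N.deg x)), (N.message A (N.run A t) x i).length ≤ B

/-- After `T` rounds all nodes have halted, with local outputs given by `out`. -/
def HaltsWith (N : CongestNetwork V) (A : CongestAlgorithm Out) (T : ℕ) (out : V → Out) : Prop :=
  ∀ x : V, A.output (N.run A T x) = some (out x)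

end CongestNetwork

/-- Local output of a node in induced `H`-detection, where `W` is the node set of `H`: whether the
input contains an induced copy of `H`, and the node of `H` whose part the node plays in the copy
that was found (`none` if it is not in that copy). -/
structure DetectionAnswer (W : Type u) where
  found : Bool
  role : Option W

/-- The local outputs solve induced `H`-detection on `G`: every node reports correctly whether `G`
contains an induced copy of `H`; if so, the roles mark one induced copy of `H` in `G`, and
otherwise nobody has a role. -/
def IsInducedDetection {V : Type v} {W : Type u} (G : SimpleGraph V) (H : SimpleGraph W)
    (out : V → DetectionAnswer W) : Prop :=
  (∀ x, (out x).found = true ↔ H.IsIndContained G) ∧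
  (H.IsIndContained G → ∃ φ : H ↪g G, ∀ x w, (out x).role = some w ↔ φ w = x) ∧
  (¬ H.IsIndContained G → ∀ x, (out x).role = none)

/-! Two nodes with the same neighbours are interchangeable in an induced copy of `H`. So if only the
nodes of degree more than `t` and the first `k + 1` nodes of each twin class are kept, some copy
survives whenever one exists (`exists_embedding_isKept`). This holds for every `t`; only the size of
the kernel depends on it. For `t ≥ τ`, a node outside a minimum vertex cover `X` has its neighbours
inside `X`, hence degree at most `t` and one of at most `2 ^ t` neighbourhoods, so at most `t + 2 ^
t * (k + 1)` nodes are kept (`ncard_isKept_le`).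

The phases try `t = 0, 1, 2, …` and stop at the first `t` whose kernel is within that bound, so `τ`
need not be known. The twins of a node are all adjacent to each of its neighbours, so a neighbour
can decide whether it is kept (`keeps_iff`). The kernel is then flooded with truncated messages.
Short flooding suffices because every distance strictly between 0 and the eccentricity of a node is
realised by a kept node (`exists_isKept_dist_eq`): a distant item would force more kept nodes nearby
than the bound allows (`flood_complete`). All nodes therefore reach the same verdict and, from the
same kernel, choose the same copy (`IsKernel.isInducedDetection`). -/

/-! ### Block protocols and the encoding of numbers as messages. -/

/-- What a node knows at the beginning. -/
structure NodeInfo where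
  idBound : ℕ
  id : ℕ
  degree : ℕ

/-- A protocol that works in phases `0, 1, 2, …`. Phase `t` consists of `blocks t` blocks, and in a
block every node sends through each port a list of at most `cap t` numbers. A phase forgets
the previous ones; if it ends with a result, then the node halts. -/
structure BlockProtocol (Out : Type u) where
  Loc : Type
  start : Loc
  send : (phase block : ℕ) → NodeInfo → Loc → (port : ℕ) → List ℕ
  step : (phase block : ℕ) → NodeInfo → Loc → List (List ℕ) → Loc
  result : (phase : ℕ) → NodeInfo → Loc → Option Out
  /-- output of a node that halts without any communication -/
  early : NodeInfo → Option Out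
  cap : ℕ → ℕ
  blocks : ℕ → ℕ
  cap_pos : ∀ t, 0 < cap t
  blocks_pos : ∀ t, 0 < blocks t

theorem Nat.bits_injective : Function.Injective Nat.bits := fun a b h =>
  Nat.eq_of_testBit_eq fun i => by rw [Nat.testBit_eq_inth, Nat.testBit_eq_inth, h]

/-- The bit string for an optional number; numbers that are not below `N ^ 2` are suppressed. -/
def encodeOption (N : ℕ) (o : Option ℕ) : List Bool :=
  ((o.filter (· < N ^ 2)).elim 0 Nat.succ).bits

/-- Silence is the code of 0, hence means that no number was sent. -/
noncomputable def decodeOption (l : List Bool) : Option ℕ :=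
  (Function.invFun Nat.bits l).ppred

theorem decodeOption_encodeOption (N : ℕ) (o : Option ℕ) :
    decodeOption (encodeOption N o) = o.filter (· < N ^ 2) := by
  rw [decodeOption, encodeOption, Function.leftInverse_invFun Nat.bits_injective]
  cases o.filter (· < N ^ 2) <;> rfl

theorem length_encodeOption_le {N L : ℕ} (h : N ^ 2 < 2 ^ L) (o : Option ℕ) :
    (encodeOption N o).length ≤ L := by
  rw [encodeOption, Nat.size_eq_bits_len, Nat.size_le]
  cases ho : o.filter (· < N ^ 2) with
  | none => simp
  | some a =>
    have : a < N ^ 2 := by simpa using (Option.filter_eq_some_iff.1 ho).2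
    simp only [Option.elim_some]
    omega

theorem List.filterMap_range_getElem? {α : Type*} (l : List α) (p : α → Bool) (n : ℕ) :
    (List.range n).filterMap (fun j => (l[j]?).filter p) = (l.take n).filter p := by
  induction n with
  | zero => simp
  | succ n ih =>
    rw [List.range_succ, List.filterMap_append, ih, List.take_add_one, List.filter_append]
    congr 1
    cases h : l[n]? with
    | none => simp [h]
    | some a => by_cases hp : p a <;> simp [h, hp, Option.filter]

namespace BlockProtocol

variable {Out : Type u} (P : BlockProtocol Out)

/-- State of a node that runs a block protocol. -/
structure NodeState where
  info : NodeInfo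
  phase : ℕ
  block : ℕ
  /-- the messages received so far in this block, by rounds and ports -/
  buffer : List (List (List Bool))
  loc : P.Loc
  answer : Option Out

/-- For each port, the list of numbers that has been received through it in a block. -/
noncomputable def tables (degree : ℕ) (buffer : List (List (List Bool))) : List (List ℕ) :=
  List.ofFn fun i : Fin degree => buffer.filterMap fun inbox => decodeOption (inbox.getD i [])

/-- State at the beginning of a phase, from the result of the previous one. -/
def phaseStart (info : NodeInfo) (t : ℕ) (answer : Option Out) : P.NodeState :=
  ⟨info, t, 0, [], P.start, answer⟩

/-- State after the messages of a block have been received. -/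
def finishBlock (s : P.NodeState) (inb : List (List ℕ)) : P.NodeState :=
  let loc := P.step s.phase s.block s.info s.loc inb
  if s.block + 1 < P.blocks s.phase then
    { s with block := s.block + 1, buffer := [], loc := loc }
  else P.phaseStart s.info (s.phase + 1) (P.result s.phase s.info loc)

/-- The `CONGEST` algorithm that runs a block protocol. -/
noncomputable def toCongest : CongestAlgorithm Out where
  State := P.NodeState
  init N i d := P.phaseStart ⟨N, i, d⟩ 0 (P.early ⟨N, i, d⟩)
  send s i := encodeOption s.info.idBound ((P.send s.phase s.block s.info s.loc i)[s.buffer.length]?)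
  receive s inbox :=
    if s.buffer.length + 1 < P.cap s.phase then { s with buffer := s.buffer ++ [inbox] }
    else P.finishBlock s (tables s.info.degree (s.buffer ++ [inbox]))
  output s := s.answer

end BlockProtocol

/-! ### Simulation of block protocols in `CONGEST`. -/

namespace CongestNetwork

variable {V : Type v} {Out : Type u} (N : CongestNetwork V) (P : BlockProtocol Out)

def info (x : V) : NodeInfo := ⟨N.idBound, N.id x, N.deg x⟩

/-- The numbers that arrive at `x` through port `i` in a block. -/
def blockInbox (t b : ℕ) (s : V → P.Loc) (x : V) (i : Fin (N.deg x)) : List ℕ :=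
  ((P.send t b (N.info (N.port x i)) (s (N.port x i)) (N.backPort x i)).take (P.cap t)).filter
    (· < N.idBound ^ 2)

/-- Local data after a number of blocks of phase `t`. -/
def blockRun (t : ℕ) : ℕ → V → P.Loc
  | 0 => fun _ => P.start
  | b + 1 => fun x => P.step t b (N.info x) (blockRun t b x)
      (List.ofFn (N.blockInbox P t b (blockRun t b) x))

theorem blockRun_succ (t b : ℕ) (x : V) : N.blockRun P t (b + 1) x =
    P.step t b (N.info x) (N.blockRun P t b x)
      (List.ofFn (N.blockInbox P t b (N.blockRun P t b) x)) := rfl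

/-- The buffer of node `x` after `j` rounds of a block. -/
def blockBuffer (t b : ℕ) (s : V → P.Loc) (x : V) (j : ℕ) : List (List (List Bool)) :=
  (List.range j).map fun j' => List.ofFn fun i : Fin (N.deg x) =>
    encodeOption N.idBound
      ((P.send t b (N.info (N.port x i)) (s (N.port x i)) (N.backPort x i))[j']?)

theorem tables_blockBuffer (t b : ℕ) (s : V → P.Loc) (x : V) :
    BlockProtocol.tables (N.deg x) (N.blockBuffer P t b s x (P.cap t)) =
      List.ofFn (N.blockInbox P t b s x) := by
  unfold BlockProtocol.tables blockBuffer blockInbox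
  congr 1
  funext i
  rw [List.filterMap_map, ← List.filterMap_range_getElem?]
  congr 1
  funext j
  simp [List.getD, decodeOption_encodeOption]

/-- Global state in phase `t` after `b` blocks and `j` further rounds. -/
def blockState (t b j : ℕ) (x : V) : P.NodeState :=
  ⟨N.info x, t, b, N.blockBuffer P t b (N.blockRun P t b) x j, N.blockRun P t b x, none⟩

theorem inbox_blockState (t b j : ℕ) (x : V) :
    N.blockBuffer P t b (N.blockRun P t b) x j ++ [N.inbox P.toCongest (N.blockState P t b j) x] =
      N.blockBuffer P t b (N.blockRun P t b) x (j + 1) := by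
  simp [blockBuffer, List.range_succ, inbox, message, blockState, BlockProtocol.toCongest, info]

theorem run_add_rounds {T t b : ℕ} (h : N.run P.toCongest T = N.blockState P t b 0) :
    ∀ j, j < P.cap t → N.run P.toCongest (T + j) = N.blockState P t b j
  | 0, _ => h
  | j + 1, hj => by
    have ih := run_add_rounds h j (by omega)
    funext x
    rw [← Nat.add_assoc, run, ih]
    have := N.inbox_blockState P t b j x
    have hl : (N.blockBuffer P t b (N.blockRun P t b) x j).length = j := by simp [blockBuffer]
    simp only [BlockProtocol.toCongest, blockState] at *
    simp [this, hl, hj]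

theorem run_add_cap {T t b : ℕ} (h : N.run P.toCongest T = N.blockState P t b 0) :
    N.run P.toCongest (T + P.cap t) = fun x =>
      P.finishBlock (N.blockState P t b 0 x)
        (List.ofFn (N.blockInbox P t b (N.blockRun P t b) x)) := by
  obtain ⟨j, hj⟩ := Nat.exists_eq_succ_of_ne_zero (P.cap_pos t).ne'
  have ih := N.run_add_rounds P h j (by omega)
  funext x
  rw [← tables_blockBuffer, hj, Nat.succ_eq_add_one, ← Nat.add_assoc, run, ih]
  have := N.inbox_blockState P t b j x
  have hl : (N.blockBuffer P t b (N.blockRun P t b) x j).length = j := by simp [blockBuffer]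
  rw [← this]
  refine (if_neg (by simp [BlockProtocol.toCongest, blockState])).trans ?_
  -- This is round `cap t` of the block: the buffer is full and the block is closed.
  refine (if_neg (by simp [blockState, hl, hj])).trans ?_
  simp [BlockProtocol.finishBlock, blockState, info]
  rfl

theorem run_add_blocks {T t : ℕ} (h : N.run P.toCongest T = N.blockState P t 0 0) :
    ∀ b, b < P.blocks t → N.run P.toCongest (T + b * P.cap t) = N.blockState P t b 0
  | 0, _ => by simpa using h
  | b + 1, hb => by
    have ih := run_add_blocks h b (by omega)
    rw [Nat.succ_mul, ← Nat.add_assoc, run_add_cap N P ih]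
    funext x
    simp [BlockProtocol.finishBlock, blockState, hb, blockBuffer, blockRun]

/-- A phase ends with its result. -/
theorem run_add_phase {T t : ℕ} (h : N.run P.toCongest T = N.blockState P t 0 0) :
    N.run P.toCongest (T + P.blocks t * P.cap t) = fun x =>
      P.phaseStart (N.info x) (t + 1) (P.result t (N.info x) (N.blockRun P t (P.blocks t) x)) := by
  obtain ⟨b, hb⟩ := Nat.exists_eq_succ_of_ne_zero (P.blocks_pos t).ne'
  have ih := N.run_add_blocks P h b (by omega)
  rw [hb, Nat.succ_mul, ← Nat.add_assoc, run_add_cap N P ih]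
  funext x
  simp [BlockProtocol.finishBlock, blockState, hb, blockRun]

theorem run_eq_blockState (hearly : ∀ x, P.early (N.info x) = none) (t : ℕ)
    (hres : ∀ s < t, ∀ x, P.result s (N.info x) (N.blockRun P s (P.blocks s) x) = none) :
    N.run P.toCongest (∑ s ∈ Finset.range t, P.blocks s * P.cap s) = N.blockState P t 0 0 := by
  induction t with
  | zero =>
    funext x
    have := hearly x
    simp only [info] at this
    simp [run, BlockProtocol.toCongest, blockState, BlockProtocol.phaseStart, blockBuffer, blockRun,
      info, this]
  | succ t ih =>
    rw [Finset.sum_range_succ, run_add_phase N P (ih fun s hs => hres s (by omega))]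
    funext x
    simp [hres t (by omega) x, blockState, BlockProtocol.phaseStart, blockBuffer, blockRun]

theorem haltsWith_of_result (hearly : ∀ x, P.early (N.info x) = none) (t : ℕ) (out : V → Out)
    (hres : ∀ s < t, ∀ x, P.result s (N.info x) (N.blockRun P s (P.blocks s) x) = none)
    (hout : ∀ x, P.result t (N.info x) (N.blockRun P t (P.blocks t) x) = some (out x)) :
    N.HaltsWith P.toCongest (∑ s ∈ Finset.range (t + 1), P.blocks s * P.cap s) out := fun x => by
  rw [Finset.sum_range_succ, run_add_phase N P (N.run_eq_blockState P hearly t hres)]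
  exact hout x

theorem haltsWith_of_early (out : V → Out) (h : ∀ x, P.early (N.info x) = some (out x)) :
    N.HaltsWith P.toCongest 0 out := h

/-- The cutoff used for encoding is therefore always that of the network, which gives the bandwidth
bound for any protocol. -/
theorem run_info (T : ℕ) (x : V) : (N.run P.toCongest T x : P.NodeState).info = N.info x := by
  induction T with
  | zero => rfl
  | succ T ih =>
    simp only [run]
    split_ifs
    · exact ih
    · simp only [BlockProtocol.toCongest, BlockProtocol.finishBlock, BlockProtocol.phaseStart] at *
      split_ifs <;> exact ih

theorem respectsBandwidth_toCongest {B : ℕ} (hB : N.idBound ^ 2 < 2 ^ B) :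
    N.RespectsBandwidth P.toCongest B := fun T x i => by
  unfold message
  split_ifs
  · simp
  · have := N.run_info P T x
    simp only [BlockProtocol.toCongest] at *
    rw [this]
    exact length_encodeOption_le hB _

end CongestNetwork

/-! ### Twin classes and the size of the kernel. -/

namespace SimpleGraph

variable {V : Type v} {W : Type u} {G : SimpleGraph V} {H : SimpleGraph W}

/-- The nodes that are kept in the kernel: those of degree more than `t`, and the first `q + 1`
(in the order given by `key`) nodes of each class of nodes with the same neighbours. -/
def IsKept (G : SimpleGraph V) (key : V → ℕ) (t q : ℕ) (y : V) : Prop :=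
  t < (G.neighborSet y).ncard ∨
    {z | G.neighborSet z = G.neighborSet y ∧ key z < key y}.ncard ≤ q

theorem adj_congr_of_neighborSet_eq {x y : V} (h : G.neighborSet x = G.neighborSet y) (z : V) :
    G.Adj x z ↔ G.Adj y z := by
  rw [← mem_neighborSet, h, mem_neighborSet]

/-- The member of the class with least key has rank 0. -/
theorem exists_isKept_twin (key : V → ℕ) (t q : ℕ) (y : V) :
    ∃ z, G.IsKept key t q z ∧ G.neighborSet z = G.neighborSet y := by
  obtain ⟨z, hz, hmin⟩ := WellFounded.has_min (measure key).wf
    {z | G.neighborSet z = G.neighborSet y} ⟨y, rfl⟩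
  refine ⟨z, Or.inr ?_, hz⟩
  have : {w | G.neighborSet w = G.neighborSet z ∧ key w < key z} = ∅ :=
    Set.eq_empty_of_forall_notMem fun w hw => hmin w (hw.1.trans hz) hw.2
  simp [this]

/-- Moving one vertex of an induced copy to an unused twin of it. -/
theorem exists_embedding_update (φ : H ↪g G) (w : W) {z : V} (hz : z ∉ Set.range φ)
    (h : G.neighborSet z = G.neighborSet (φ w)) :
    ∃ ψ : H ↪g G, ψ w = z ∧ ∀ a, a ≠ w → ψ a = φ a := by
  classical
  have hz' : ∀ a, φ a ≠ z := fun a ha => hz ⟨a, ha⟩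
  have hadj := adj_congr_of_neighborSet_eq h
  have hinj : Function.Injective (Function.update φ w z) := fun a b hab => by
    by_cases ha : a = w <;> by_cases hb : b = w
    · rw [ha, hb]
    · subst ha
      rw [Function.update_self, Function.update_of_ne hb] at hab
      exact (hz' b hab.symm).elim
    · subst hb
      rw [Function.update_self, Function.update_of_ne ha] at hab
      exact (hz' a hab).elim
    · rw [Function.update_of_ne ha, Function.update_of_ne hb] at hab
      exact φ.injective hab
  refine ⟨⟨⟨Function.update φ w z, hinj⟩, fun {a b} => ?_⟩, Function.update_self w z φ,
    fun a ha => Function.update_of_ne ha z φ⟩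
  change G.Adj (Function.update φ w z a) (Function.update φ w z b) ↔ H.Adj a b
  by_cases ha : a = w <;> by_cases hb : b = w
  · simp [ha, hb]
  · subst ha
    rw [Function.update_self, Function.update_of_ne hb, hadj, φ.map_adj_iff]
  · subst hb
    rw [Function.update_self, Function.update_of_ne ha, G.adj_comm, hadj, φ.map_adj_iff,
      H.adj_comm]
  · rw [Function.update_of_ne ha, Function.update_of_ne hb, φ.map_adj_iff]

/-- Take a copy with least sum of keys. A vertex of it that is not kept has more than `q` twins of
smaller key; the copy cannot occupy all of them, and moving to a free one decreases the sum. -/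
theorem exists_embedding_isKept [Fintype W] (key : V → ℕ) (t : ℕ) {q : ℕ}
    (hq : Fintype.card W ≤ q) (φ : H ↪g G) : ∃ ψ : H ↪g G, ∀ w, G.IsKept key t q (ψ w) := by
  obtain ⟨ψ, -, hmin⟩ := WellFounded.has_min
    (measure fun ψ : H ↪g G => ∑ w, key (ψ w)).wf Set.univ ⟨φ, trivial⟩
  refine ⟨ψ, fun w => ?_⟩
  by_contra hw
  simp only [IsKept, not_or, not_le] at hw
  have hcard : (Set.range ψ).ncard ≤ q := by
    rw [← Set.image_univ]
    exact (Set.ncard_image_le (s := Set.univ)).trans (by simpa [Set.ncard_univ] using hq)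
  obtain ⟨z, ⟨hz, hlt⟩, hzr⟩ := Set.exists_mem_notMem_of_ncard_lt_ncard (hcard.trans_lt hw.2)
    (Set.finite_range ψ)
  obtain ⟨χ, hχ, hχ'⟩ := exists_embedding_update ψ w hzr hz
  refine hmin χ trivial (Finset.sum_lt_sum (f := fun a => key (χ a)) (fun a _ => ?_) ⟨w, Finset.mem_univ _, ?_⟩)
  · by_cases ha : a = w
    · subst ha; rw [hχ]; exact hlt.le
    · rw [hχ' a ha]
  · rw [hχ]; exact hlt

/-- Outside `X`, a kept node is determined by its neighbourhood, a subset of `X`, and its rank in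
the twin class, at most `q`. -/
theorem ncard_isKept_le [Finite V] {key : V → ℕ} (hkey : Function.Injective key) {X : Set V}
    (hX : G.IsVertexCover X) {t q : ℕ} (ht : X.ncard ≤ t) :
    {y | G.IsKept key t q y}.ncard ≤ t + 2 ^ t * (q + 1) := by
  have hsub : ∀ y, y ∉ X → G.neighborSet y ⊆ X := fun y hy z hz => (hX hz).resolve_left hy
  let rank : V → ℕ := fun y => {z | G.neighborSet z = G.neighborSet y ∧ key z < key y}.ncard
  have hrank : ∀ y ∈ {y | G.IsKept key t q y} \ X, rank y ≤ q := fun y hy => by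
    refine hy.1.resolve_left fun h => ?_
    have := Set.ncard_le_ncard (hsub y hy.2)
    omega
  have hlt : ∀ {y y'}, G.neighborSet y = G.neighborSet y' → key y < key y' →
      rank y < rank y' := fun {y y'} h hk => by
    refine Set.ncard_lt_ncard ⟨fun z hz => ⟨hz.1.trans h, hz.2.trans hk⟩, fun hs => ?_⟩
    exact lt_irrefl _ (hs ⟨h, hk⟩ : _ ∧ _).2
  have hout : ({y | G.IsKept key t q y} \ X).ncard ≤ 2 ^ t * (q + 1) := by
    calc _ ≤ ((𝒫 X) ×ˢ Set.Iic q).ncard := by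
          refine Set.ncard_le_ncard_of_injOn (fun y => (G.neighborSet y, rank y))
            (fun y hy => ⟨hsub y hy.2, hrank y hy⟩) (fun y _ y' _ h => ?_)
            ((Set.toFinite _).prod (Set.finite_Iic q))
          simp only [Prod.mk.injEq] at h
          rcases lt_trichotomy (key y) (key y') with hk | hk | hk
          · exact absurd h.2 (hlt h.1 hk).ne
          · exact hkey hk
          · exact absurd h.2 (hlt h.1.symm hk).ne'
      _ = 2 ^ X.ncard * (q + 1) := by
          rw [Set.ncard_prod, Set.ncard_powerset, ← Finset.coe_Iic, Set.ncard_coe_finset,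
            Nat.card_Iic]
      _ ≤ _ := Nat.mul_le_mul_right _ (Nat.pow_le_pow_right (by norm_num) ht)
  calc _ ≤ (X ∪ ({y | G.IsKept key t q y} \ X)).ncard :=
        Set.ncard_le_ncard (fun y hy => by by_cases h : y ∈ X <;> simp [h]; exact hy)
    _ ≤ X.ncard + _ := Set.ncard_union_le _ _
    _ ≤ _ := Nat.add_le_add ht hout

/-! ### Distances and flooding. -/

theorem Connected.exists_adj_dist_eq (hG : G.Connected) {x v : V} {d : ℕ}
    (h : G.dist x v = d + 1) : ∃ w, G.Adj w v ∧ G.dist x w = d := by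
  obtain ⟨p, hp⟩ := hG.exists_walk_length_eq_dist v x
  rw [dist_comm, h] at hp
  cases p with
  | nil => simp at hp
  | @cons _ w _ hvw p =>
    refine ⟨w, hvw.symm, le_antisymm ?_ ?_⟩
    · rw [dist_comm]
      exact (dist_le p).trans (by simpa using hp.le)
    · have := hG.dist_triangle (u := x) (v := w) (w := v)
      rw [h, dist_eq_one_iff_adj.2 hvw.symm] at this
      omega

theorem Connected.exists_dist_eq (hG : G.Connected) {x v : V} {d : ℕ} (h : d ≤ G.dist x v) :
    ∃ w, G.dist x w = d := by
  induction h using Nat.decreasingInduction with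
  | self => exact ⟨v, rfl⟩
  | of_succ k _ ih =>
    obtain ⟨w, hw⟩ := ih
    obtain ⟨w', -, hw'⟩ := hG.exists_adj_dist_eq hw
    exact ⟨w', hw'⟩

/-- On a geodesic take consecutive nodes `a`, `b`, `c` with `b` at distance `d + 1`. A kept twin of
`b` is adjacent to `a` and `c`, so it has the same distance. The node `c` is why `v` must lie
farther than `d + 1`. -/
theorem Connected.exists_isKept_dist_eq (hG : G.Connected) (key : V → ℕ) (t q : ℕ) {x v : V}
    {d : ℕ} (h : d + 1 < G.dist x v) : ∃ z, G.IsKept key t q z ∧ G.dist x z = d + 1 := by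
  obtain ⟨c, hc⟩ := hG.exists_dist_eq (d := d + 2) h
  obtain ⟨b, hbc, hb⟩ := hG.exists_adj_dist_eq hc
  obtain ⟨a, hab, ha⟩ := hG.exists_adj_dist_eq hb
  obtain ⟨z, hz, hzb⟩ := G.exists_isKept_twin key t q b
  have hza := (adj_congr_of_neighborSet_eq hzb a).2 hab.symm
  have hzc := (adj_congr_of_neighborSet_eq hzb c).2 hbc
  have h1 := hG.dist_triangle (u := x) (v := a) (w := z)
  have h2 := hG.dist_triangle (u := x) (v := z) (w := c)
  rw [dist_eq_one_iff_adj.2 hza.symm] at h1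
  rw [dist_eq_one_iff_adj.2 hzc] at h2
  exact ⟨z, hz, by omega⟩

/-- Flooding with bounded messages: in each step a node `x` adds to its set `I s x` the part
`f (I s y)` of the set of each neighbour `y`, where `f` may truncate only sets of more than `m`
elements, and leaves more than `m` elements of those. -/
theorem Connected.flood {α : Type*} (hG : G.Connected) {m : ℕ} {f : Finset α → Finset α}
    {I : ℕ → V → Finset α} (hf : ∀ S : Finset α, S.card ≤ m → f S = S)
    (hf' : ∀ S : Finset α, m < S.card → m < (f S).card)
    (hI : ∀ s x a, a ∈ I (s + 1) x ↔ a ∈ I s x ∨ ∃ y, G.Adj x y ∧ a ∈ f (I s y)) (s : ℕ) (x : V) :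
    m < (I s x).card ∨ ∀ y, G.dist x y ≤ s → I 0 y ⊆ I s x := by
  induction s generalizing x with
  | zero =>
    refine Or.inr fun y hy => ?_
    rw [hG.dist_eq_zero_iff.1 (Nat.le_zero.1 hy)]
  | succ s ih =>
    by_contra! hcon
    obtain ⟨hm, y, hy, hsub⟩ := hcon
    -- As `x` still has at most `m` elements, no neighbour can have sent a truncated set.
    have hstep : ∀ z, G.Adj x z → I s z ⊆ I (s + 1) x := fun z hz => by
      have hfz : f (I s z) ⊆ I (s + 1) x := fun a ha => (hI s x a).2 (Or.inr ⟨z, hz, ha⟩)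
      rw [← hf (I s z)]
      · exact hfz
      · by_contra! hlt
        exact absurd ((hf' _ hlt).trans_le (Finset.card_le_card hfz)) (by omega)
    have hself : I s x ⊆ I (s + 1) x := fun a ha => (hI s x a).2 (Or.inl ha)
    rcases Nat.lt_or_ge s (G.dist x y) with hlt | hle
    · have hd : G.dist y x = s + 1 := by rw [dist_comm]; omega
      obtain ⟨z, hz, hzy⟩ := hG.exists_adj_dist_eq hd
      have hc := Finset.card_le_card (hstep z hz.symm)
      rcases ih z with h | h
      · omega
      · exact hsub ((h y (by rw [dist_comm]; omega)).trans (hstep z hz.symm))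
    · have hc := Finset.card_le_card hself
      rcases ih x with h | h
      · omega
      · exact hsub ((h y hle).trans hself)

/-- If every kept node starts with an item of its own, then after `m + 1` steps of flooding either
every node knows all items and these are at most `m`, or every node knows more than `m` of them. -/
theorem Connected.flood_complete {α : Type*} (hG : G.Connected) {m : ℕ} {f : Finset α → Finset α}
    {I : ℕ → V → Finset α} (hfs : ∀ S, f S ⊆ S) (hf : ∀ S : Finset α, S.card ≤ m → f S = S)
    (hf' : ∀ S : Finset α, m < S.card → m < (f S).card)
    (hI : ∀ s x a, a ∈ I (s + 1) x ↔ a ∈ I s x ∨ ∃ y, G.Adj x y ∧ a ∈ f (I s y))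
    {U : Finset α} (hU : ∀ a, a ∈ U ↔ ∃ x, a ∈ I 0 x)
    {key : V → ℕ} {t q : ℕ} {item : V → α} (hinj : Function.Injective item)
    (hitem : ∀ z, G.IsKept key t q z → item z ∈ I 0 z) (x : V) :
    ((I (m + 1) x).card ≤ m ↔ U.card ≤ m) ∧ (U.card ≤ m → I (m + 1) x = U) := by
  have hsub : ∀ s x, I s x ⊆ U := fun s => by
    induction s with
    | zero => exact fun x a ha => (hU a).2 ⟨x, ha⟩
    | succ s ih =>
      intro x a ha
      rcases (hI s x a).1 ha with h | ⟨y, -, h⟩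
      · exact ih x h
      · exact ih y (hfs _ h)
  have key' : (I (m + 1) x).card ≤ m → I (m + 1) x = U := fun hc => by
    have hball := (hG.flood hf hf' hI (m + 1) x).resolve_left (by omega)
    refine (hsub _ _).antisymm fun a ha => ?_
    obtain ⟨y, hy⟩ := (hU a).1 ha
    refine hball y ?_ hy
    -- Otherwise kept nodes at the distances `1, …, m + 1` have all been heard of, which makes `m +
    -- 1` distinct items.
    by_contra! hlt
    have hex : ∀ d : Fin (m + 1), ∃ z, G.IsKept key t q z ∧ G.dist x z = d + 1 := fun d =>
      hG.exists_isKept_dist_eq key t q (v := y) (by omega)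
    choose z hz hd using hex
    have : Finset.card (Finset.univ : Finset (Fin (m + 1))) ≤ (I (m + 1) x).card := by
      refine Finset.card_le_card_of_injOn (fun d => item (z d)) (fun d _ => ?_) fun d _ d' _ h => ?_
      · exact hball (z d) (by rw [hd]; omega) (hitem _ (hz d))
      · have := congrArg (G.dist x) (hinj h)
        rw [hd, hd] at this
        exact Fin.ext (by omega)
    simp at this
    omega
  have hc := Finset.card_le_card (hsub (m + 1) x)
  refine ⟨⟨fun h => key' h ▸ h, fun h => hc.trans h⟩, fun h => key' (hc.trans h)⟩

end SimpleGraph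

/-! ### The kernel protocol. -/

section KernelProtocol

variable {W : Type u}

/-- `φ` gives the identifiers of an induced copy of `H`, where `I` encodes the pairs `(a, b)` of
identifiers of kept nodes with `a = b` or adjacent nodes. -/
def IsCopy (H : SimpleGraph W) (I : Finset ℕ) (φ : W → ℕ) : Prop :=
  Function.Injective φ ∧ (∀ w, Nat.pair (φ w) (φ w) ∈ I) ∧
    ∀ w w', H.Adj w w' ↔ w ≠ w' ∧ Nat.pair (φ w) (φ w') ∈ I

open Classical in
/-- The answer of the node with identifier `id`, from the kernel. -/
noncomputable def kernelAnswer (H : SimpleGraph W) (I : Finset ℕ) (id : ℕ) : DetectionAnswer W :=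
  if h : ∃ φ, IsCopy H I φ then
    ⟨true, if h' : ∃ w, h.choose w = id then some h'.choose else none⟩
  else ⟨false, none⟩

/-- Local data of the kernel protocol. -/
structure KernelData where
  /-- identifiers of the neighbours, by ports -/
  nbrs : List ℕ
  /-- identifiers of the neighbours of the neighbours (possibly truncated), by ports -/
  nbhds : List (List ℕ)
  /-- encoded pairs of adjacent kept nodes -/
  items : Finset ℕ

namespace KernelData

/-- The neighbour at port `i` is recognized as a kept node. -/
def Keeps (t q : ℕ) (σ : KernelData) (i : ℕ) : Prop :=
  t < (σ.nbhds.getD i []).length ∨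
    {j ∈ Finset.range σ.nbrs.length | (σ.nbhds.getD j []).toFinset = (σ.nbhds.getD i []).toFinset ∧
      σ.nbrs.getD j 0 < σ.nbrs.getD i 0}.card ≤ q

open Classical in
/-- The items of a kept node: itself and its kept neighbours. -/
noncomputable def ownItems (t q id : ℕ) (σ : KernelData) : Finset ℕ :=
  insert (Nat.pair id id)
    ({i ∈ Finset.range σ.nbrs.length | σ.Keeps t q i}.image fun i => Nat.pair id (σ.nbrs.getD i 0))

end KernelData

/-- Bound on the number of items in phase `t`. -/
def itemBound (q t : ℕ) : ℕ := (t + 2 ^ t * (q + 1)) ^ 2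

open Classical in
/-- The protocol that computes in phase `t` the kernel for the degree threshold `t` and answers if
it is small. -/
noncomputable def kernelProtocol [Fintype W] (H : SimpleGraph W) :
    BlockProtocol (DetectionAnswer W) where
  Loc := KernelData
  start := ⟨[], [], ∅⟩
  send t b info σ i := match b with
    | 0 => [info.id]
    | 1 => σ.nbrs
    | 2 => if σ.Keeps t (Fintype.card W) i then [0] else []
    | _ + 3 => σ.items.toList
  step t b info σ inb := match b with
    | 0 => { σ with nbrs := inb.flatten }
    | 1 => { σ with nbhds := inb }
    -- All neighbours reach the same verdict, so one nonempty message means that the node is kept.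
    | 2 => { σ with items := if inb.flatten = [] then ∅ else σ.ownItems t (Fintype.card W) info.id }
    | _ + 3 => { σ with items := σ.items ∪ inb.flatten.toFinset }
  result t info σ :=
    if σ.items.card ≤ itemBound (Fintype.card W) t then some (kernelAnswer H σ.items info.id)
    else none
  early info :=
    if info.degree = 0 then some (kernelAnswer H {Nat.pair info.id info.id} info.id) else none
  -- One more than the bound, so that truncation cannot hide an overflow.
  cap t := itemBound (Fintype.card W) t + 1
  -- Three preparatory blocks and `itemBound + 1` steps of flooding.
  blocks t := itemBound (Fintype.card W) t + 4
  cap_pos _ := Nat.succ_pos _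
  blocks_pos _ := Nat.succ_pos _

/-- Ensures that truncated neighbourhoods still show whether a degree exceeds `t`. -/
theorem lt_itemBound (q t : ℕ) : t < itemBound q t := by
  have : 0 < 2 ^ t * (q + 1) := by positivity
  unfold itemBound
  nlinarith

end KernelProtocol

/-! ### Correctness and size of the kernel. -/

namespace CongestNetwork

open SimpleGraph

variable {V : Type v} {W : Type u} (N : CongestNetwork V)

/-- The identifier of a node, as a number. -/
def key (x : V) : ℕ := N.id x

theorem key_injective : Function.Injective N.key :=
  Fin.val_injective.comp N.id.injective

theorem key_lt (x : V) : N.key x < N.idBound := (N.id x).2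

theorem key_lt_sq (x : V) : N.key x < N.idBound ^ 2 :=
  (N.key_lt x).trans_le (Nat.le_self_pow two_ne_zero _)

/-- Items lie in the range of numbers that the encoding transmits. -/
theorem pair_key_lt (x y : V) : Nat.pair (N.key x) (N.key y) < N.idBound ^ 2 :=
  (Nat.pair_lt_max_add_one_sq _ _).trans_le
    (Nat.pow_le_pow_left (by have := N.key_lt x; have := N.key_lt y; omega) 2)

theorem ncard_neighborSet (x : V) : (N.graph.neighborSet x).ncard = N.deg x := by
  rw [← Nat.card_coe_set_eq, ← Nat.card_congr (N.port x), Nat.card_eq_fintype_card, Fintype.card_fin]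

theorem exists_port {x y : V} (h : N.graph.Adj x y) : ∃ i, (N.port x i : V) = y :=
  ⟨(N.port x).symm ⟨y, h⟩, by simp⟩

theorem adj_port (x : V) (i : Fin (N.deg x)) : N.graph.Adj x (N.port x i) := (N.port x i).2

theorem port_backPort (x : V) (i : Fin (N.deg x)) :
    (N.port (N.port x i) (N.backPort x i) : V) = x := by
  simp [backPort]

/-- `U` is the set of items of the kernel. -/
def IsKernel (t q : ℕ) (U : Finset ℕ) : Prop :=
  ∀ a, a ∈ U ↔ ∃ x y, N.graph.IsKept N.key t q x ∧ N.graph.IsKept N.key t q y ∧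
    (x = y ∨ N.graph.Adj x y) ∧ a = Nat.pair (N.key x) (N.key y)

variable {N}

theorem IsKernel.pair_mem {t q : ℕ} {U : Finset ℕ} (hU : N.IsKernel t q U) {x y : V} :
    Nat.pair (N.key x) (N.key y) ∈ U ↔ N.graph.IsKept N.key t q x ∧ N.graph.IsKept N.key t q y ∧
      (x = y ∨ N.graph.Adj x y) := by
  rw [hU]
  constructor
  · rintro ⟨x', y', hx, hy, h, heq⟩
    rw [Nat.pair_eq_pair] at heq
    obtain rfl := N.key_injective heq.1
    obtain rfl := N.key_injective heq.2
    exact ⟨hx, hy, h⟩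
  · rintro ⟨hx, hy, h⟩
    exact ⟨x, y, hx, hy, h, rfl⟩

theorem IsKernel.isCopy {H : SimpleGraph W} {t q : ℕ} {U : Finset ℕ}
    (hU : N.IsKernel t q U) (ψ : H ↪g N.graph) (hψ : ∀ w, N.graph.IsKept N.key t q (ψ w)) :
    IsCopy H U fun w => N.key (ψ w) := by
  refine ⟨N.key_injective.comp ψ.injective, fun w => hU.pair_mem.2 ⟨hψ w, hψ w, Or.inl rfl⟩,
    fun w w' => ?_⟩
  rw [hU.pair_mem, ψ.map_adj_iff, ψ.injective.eq_iff]
  exact ⟨fun h => ⟨h.ne, hψ w, hψ w', Or.inr h⟩, fun h => h.2.2.2.resolve_left h.1⟩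

theorem IsKernel.exists_embedding {H : SimpleGraph W} {t q : ℕ} {U : Finset ℕ}
    (hU : N.IsKernel t q U) {φ : W → ℕ} (hφ : IsCopy H U φ) :
    ∃ ψ : H ↪g N.graph, ∀ w, N.key (ψ w) = φ w := by
  have hex : ∀ w, ∃ x, N.key x = φ w := fun w => by
    obtain ⟨x, y, -, -, -, h⟩ := (hU _).1 (hφ.2.1 w)
    exact ⟨x, (Nat.pair_eq_pair.1 h).1.symm⟩
  choose ψ hψ using hex
  have hinj : Function.Injective ψ := fun a b hab => hφ.1 (by rw [← hψ, ← hψ, hab])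
  refine ⟨⟨⟨ψ, hinj⟩, fun {a b} => ?_⟩, hψ⟩
  change N.graph.Adj (ψ a) (ψ b) ↔ _
  rw [hφ.2.2, ← hψ, ← hψ, hU.pair_mem]
  have ha := (hU.pair_mem.1 (by rw [hψ]; exact hφ.2.1 a : Nat.pair (N.key (ψ a)) (N.key (ψ a)) ∈ U)).1
  have hb := (hU.pair_mem.1 (by rw [hψ]; exact hφ.2.1 b : Nat.pair (N.key (ψ b)) (N.key (ψ b)) ∈ U)).1
  exact ⟨fun h => ⟨fun hab => h.ne (congrArg ψ hab), ha, hb, Or.inr h⟩,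
    fun h => h.2.2.2.resolve_left fun hab => h.1 (hinj hab)⟩

/-- The copy chosen in `kernelAnswer` depends only on `H` and `U`, so the roles given by different
nodes are consistent. No relation between `t` and `τ` is needed. -/
theorem IsKernel.isInducedDetection [Fintype W] (H : SimpleGraph W) {t q : ℕ}
    (hq : Fintype.card W ≤ q) {U : Finset ℕ} (hU : N.IsKernel t q U) :
    IsInducedDetection N.graph H fun x => kernelAnswer H U (N.key x) := by
  have hiff : (∃ φ, IsCopy H U φ) ↔ H.IsIndContained N.graph :=
    ⟨fun ⟨φ, hφ⟩ => ⟨(hU.exists_embedding hφ).choose⟩, fun ⟨φ⟩ =>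
      have ⟨ψ, hψ⟩ := exists_embedding_isKept N.key t hq φ
      ⟨_, hU.isCopy ψ hψ⟩⟩
  unfold kernelAnswer
  refine ⟨fun x => ?_, fun h => ?_, fun h x => ?_⟩
  · rw [← hiff]
    split_ifs with h <;> simp [h]
  · have h' := hiff.2 h
    obtain ⟨ψ, hψ⟩ := hU.exists_embedding h'.choose_spec
    refine ⟨ψ, fun x w => ?_⟩
    simp only [dif_pos h']
    split_ifs with hx
    · have := hx.choose_spec
      rw [← hψ] at this
      have hx' := N.key_injective this
      rw [Option.some_inj, ← ψ.injective.eq_iff, hx', eq_comm]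
    · simp only [false_iff]
      exact fun hw => hx ⟨w, by rw [← hψ, hw]⟩
  · simp only [dif_neg (mt hiff.1 h)]

theorem IsKernel.card_le [Finite V] {t q : ℕ} {U : Finset ℕ} (hU : N.IsKernel t q U) {X : Set V}
    (hX : N.graph.IsVertexCover X) (ht : X.ncard ≤ t) : U.card ≤ itemBound q t := by
  have hsub : (U : Set ℕ) ⊆ (fun p : V × V => Nat.pair (N.key p.1) (N.key p.2)) ''
      ({y | N.graph.IsKept N.key t q y} ×ˢ {y | N.graph.IsKept N.key t q y}) := fun a ha => by
    obtain ⟨x, y, hx, hy, -, rfl⟩ := (hU a).1 ha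
    exact ⟨(x, y), ⟨hx, hy⟩, rfl⟩
  rw [← Set.ncard_coe_finset]
  refine (Set.ncard_le_ncard hsub).trans ((Set.ncard_image_le (Set.toFinite _)).trans ?_)
  rw [Set.ncard_prod, itemBound, sq]
  have := ncard_isKept_le (q := q) N.key_injective hX ht
  exact Nat.mul_le_mul this this

end CongestNetwork

/-! ### Execution of one phase. -/

namespace CongestNetwork

open SimpleGraph

variable {V : Type v} {W : Type u} (N : CongestNetwork V)

/-- The identifiers of the neighbours of a node, by ports. -/
def nbrKeys (x : V) : List ℕ := List.ofFn fun i => N.key (N.port x i)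

theorem length_nbrKeys (x : V) : (N.nbrKeys x).length = N.deg x := by simp [nbrKeys]

theorem nbrKeys_getD (x : V) (i : Fin (N.deg x)) :
    (N.nbrKeys x).getD i 0 = N.key (N.port x i) := by
  simp [nbrKeys, List.getD]

theorem mem_nbrKeys {x : V} {a : ℕ} : a ∈ N.nbrKeys x ↔ ∃ y, N.graph.Adj x y ∧ N.key y = a := by
  rw [nbrKeys, List.mem_ofFn]
  constructor
  · rintro ⟨i, hi⟩
    exact ⟨_, N.adj_port x i, hi⟩
  · rintro ⟨y, hy, ha⟩
    obtain ⟨i, rfl⟩ := N.exists_port hy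
    exact ⟨i, ha⟩

theorem nodup_nbrKeys (x : V) : (N.nbrKeys x).Nodup :=
  List.nodup_ofFn.2 (N.key_injective.comp
    (Subtype.val_injective.comp (N.port x).injective))

theorem nbrKeys_toFinset_eq_iff {x y : V} :
    (N.nbrKeys x).toFinset = (N.nbrKeys y).toFinset ↔
      N.graph.neighborSet x = N.graph.neighborSet y := by
  have hmem : ∀ {x z}, N.key z ∈ (N.nbrKeys x).toFinset ↔ z ∈ N.graph.neighborSet x := by
    intro x z
    rw [List.mem_toFinset, mem_nbrKeys, mem_neighborSet]
    exact ⟨fun ⟨y, hy, h⟩ => N.key_injective h ▸ hy, fun h => ⟨z, h, rfl⟩⟩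
  constructor
  · intro h
    ext z
    rw [← hmem, h, hmem]
  · intro h
    ext a
    rw [List.mem_toFinset, List.mem_toFinset, mem_nbrKeys, mem_nbrKeys]
    simp only [← mem_neighborSet, h]

/-- If `x` has degree above `m`, its truncated list still has `m + 1` distinct entries, too many to
agree with that of `y`. -/
theorem take_nbrKeys_toFinset_eq_iff {x y : V} {m : ℕ} (hy : N.deg y ≤ m) :
    ((N.nbrKeys x).take (m + 1)).toFinset = ((N.nbrKeys y).take (m + 1)).toFinset ↔
      N.graph.neighborSet x = N.graph.neighborSet y := by
  rw [List.take_of_length_le (l := N.nbrKeys y) (by rw [length_nbrKeys]; omega)]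
  by_cases hx : N.deg x ≤ m
  · rw [List.take_of_length_le (by rw [length_nbrKeys]; omega), nbrKeys_toFinset_eq_iff]
  · constructor
    · intro h
      have := congrArg Finset.card h
      rw [List.toFinset_card_of_nodup ((N.nodup_nbrKeys x).take),
        List.toFinset_card_of_nodup (N.nodup_nbrKeys y), List.length_take, length_nbrKeys,
        length_nbrKeys] at this
      omega
    · intro h
      have := congrArg Set.ncard h
      rw [ncard_neighborSet, ncard_neighborSet] at this
      omega

/-- Recognizing the kept nodes from the neighbours and their truncated neighbourhoods. -/
theorem keeps_iff {t q m : ℕ} (htm : t ≤ m) (w : V) (i : Fin (N.deg w)) (I : Finset ℕ) :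
    (⟨N.nbrKeys w, List.ofFn fun i => (N.nbrKeys (N.port w i)).take (m + 1), I⟩ :
      KernelData).Keeps t q i ↔ N.graph.IsKept N.key t q (N.port w i) := by
  obtain ⟨y, hy⟩ : ∃ y : V, y = N.port w i := ⟨_, rfl⟩
  rw [← hy]
  have hget : ∀ j : Fin (N.deg w), (List.ofFn fun i : Fin (N.deg w) =>
      (N.nbrKeys (N.port w i)).take (m + 1)).getD j [] =
        (N.nbrKeys (N.port w j)).take (m + 1) := fun j => by simp [List.getD]
  unfold KernelData.Keeps IsKept
  rw [ncard_neighborSet, hget, ← hy, List.length_take, length_nbrKeys]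
  by_cases hlow : N.deg y ≤ t
  · rw [or_iff_right (by omega), or_iff_right (by omega)]
    -- Twins of `y` are neighbours of `w`, so the rank of `y` can be computed at the ports of `w`.
    have hfin : {z | N.graph.neighborSet z = N.graph.neighborSet y ∧ N.key z < N.key y} =
        (fun j : Fin (N.deg w) => (N.port w j : V)) ''
          {j | N.graph.neighborSet (N.port w j) = N.graph.neighborSet y ∧
            N.key (N.port w j) < N.key y} := by
      ext z
      constructor
      · rintro ⟨hz, hlt⟩
        obtain ⟨j, rfl⟩ := N.exists_port
          ((adj_congr_of_neighborSet_eq hz w).2 (hy ▸ N.adj_port w i).symm).symm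
        exact ⟨j, ⟨hz, hlt⟩, rfl⟩
      · rintro ⟨j, hj, rfl⟩
        exact hj
    have himg : ((Finset.range (N.nbrKeys w).length).filter fun j =>
        ((List.ofFn fun i : Fin (N.deg w) => (N.nbrKeys (N.port w i)).take (m + 1)).getD j
          []).toFinset = ((N.nbrKeys y).take (m + 1)).toFinset ∧
        (N.nbrKeys w).getD j 0 < (N.nbrKeys w).getD i 0 : Set ℕ) =
        Fin.val '' {j : Fin (N.deg w) | N.graph.neighborSet (N.port w j) = N.graph.neighborSet y ∧
            N.key (N.port w j) < N.key y} := by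
      ext j
      simp only [Finset.coe_filter, Finset.mem_range, length_nbrKeys, Set.mem_ofPred_eq,
        Set.mem_image]
      have hj' : ∀ j : Fin (N.deg w), (((List.ofFn fun i : Fin (N.deg w) =>
          (N.nbrKeys (N.port w i)).take (m + 1)).getD j []).toFinset =
            ((N.nbrKeys y).take (m + 1)).toFinset ∧
          (N.nbrKeys w).getD j 0 < (N.nbrKeys w).getD i 0) ↔
          (N.graph.neighborSet (N.port w j) = N.graph.neighborSet y ∧
            N.key (N.port w j) < N.key y) := fun j => by
        rw [hget, N.take_nbrKeys_toFinset_eq_iff (by omega), nbrKeys_getD, nbrKeys_getD, ← hy]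
      constructor
      · rintro ⟨hj, h⟩
        exact ⟨⟨j, hj⟩, (hj' ⟨j, hj⟩).1 h, rfl⟩
      · rintro ⟨j, h, rfl⟩
        exact ⟨j.2, (hj' j).2 h⟩
    rw [← Set.ncard_coe_finset, himg, hfin, Set.ncard_image_of_injective _ Fin.val_injective,
      Set.ncard_image_of_injective]
    exact Subtype.val_injective.comp (N.port w).injective
  · exact iff_of_true (Or.inl (by omega)) (Or.inl (by omega))

variable [Fintype W] (H : SimpleGraph W) (t : ℕ)

theorem filter_nbrKeys (x : V) (k : ℕ) :
    ((N.nbrKeys x).take k).filter (· < N.idBound ^ 2) = (N.nbrKeys x).take k := by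
  refine List.filter_eq_self.2 fun a ha => ?_
  obtain ⟨y, -, rfl⟩ := N.mem_nbrKeys.1 (List.mem_of_mem_take ha)
  simpa using N.key_lt_sq y

theorem blockRun_kernel_one (x : V) :
    N.blockRun (kernelProtocol H) t 1 x = ⟨N.nbrKeys x, [], ∅⟩ := by
  have h : N.blockInbox (kernelProtocol H) t 0 (N.blockRun (kernelProtocol H) t 0) x =
      fun i => [N.key (N.port x i)] := by
    funext i
    have := N.key_lt_sq (N.port x i)
    simpa [blockInbox, kernelProtocol, info, key] using this
  rw [blockRun_succ, h]
  simp only [kernelProtocol, blockRun, nbrKeys]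
  congr 1
  have := List.map_ofFn (f := fun i => N.key (N.port x i)) (g := fun a => [a])
  rw [Function.comp_def] at this
  rw [← this, ← List.flatMap_def, List.flatMap_singleton']

theorem blockRun_kernel_two (x : V) :
    N.blockRun (kernelProtocol H) t 2 x = ⟨N.nbrKeys x,
      List.ofFn fun i => (N.nbrKeys (N.port x i)).take (itemBound (Fintype.card W) t + 1), ∅⟩ := by
  have h : N.blockInbox (kernelProtocol H) t 1 (N.blockRun (kernelProtocol H) t 1) x =
      fun i => (N.nbrKeys (N.port x i)).take (itemBound (Fintype.card W) t + 1) := by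
    funext i
    rw [← filter_nbrKeys, blockInbox, blockRun_kernel_one]
    rfl
  rw [blockRun_succ, h, blockRun_kernel_one]
  rfl

theorem keeps_blockRun_two (x : V) (i : Fin (N.deg x)) :
    (N.blockRun (kernelProtocol H) t 2 x : KernelData).Keeps t (Fintype.card W) i ↔
      N.graph.IsKept N.key t (Fintype.card W) (N.port x i) := by
  rw [blockRun_kernel_two]
  exact N.keeps_iff (lt_itemBound _ t).le x i ∅

/-- The items of a node after `s` steps of flooding in phase `t`. -/
noncomputable def floodItems (s : ℕ) (x : V) : Finset ℕ :=
  (N.blockRun (kernelProtocol H) t (s + 3) x : KernelData).items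

variable {N} in
theorem mem_floodItems_zero (hdeg : ∀ x, N.deg x ≠ 0) {x : V} {a : ℕ} :
    a ∈ N.floodItems H t 0 x ↔ ∃ y, N.graph.IsKept N.key t (Fintype.card W) x ∧
      N.graph.IsKept N.key t (Fintype.card W) y ∧ (x = y ∨ N.graph.Adj x y) ∧
      a = Nat.pair (N.key x) (N.key y) := by
  classical
  have h : N.blockInbox (kernelProtocol H) t 2 (N.blockRun (kernelProtocol H) t 2) x =
      fun i => if N.graph.IsKept N.key t (Fintype.card W) x then [0] else [] := by
    funext i
    -- The neighbour at port `i` judges `x` as the node behind its own back port.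
    have h1 := N.keeps_blockRun_two H t (N.port x i) (N.backPort x i)
    rw [port_backPort] at h1
    have h2 : 0 < N.idBound := (Nat.zero_le _).trans_lt (N.key_lt x)
    simp only [blockInbox, kernelProtocol] at h1 ⊢
    simp only [h1]
    split_ifs <;> simp [Nat.pow_pos h2]
  have h3 := N.keeps_blockRun_two H t x
  have h4 : N.floodItems H t 0 x = if N.graph.IsKept N.key t (Fintype.card W) x then
      (N.blockRun (kernelProtocol H) t 2 x : KernelData).ownItems t (Fintype.card W) (N.key x)
      else ∅ := by
    rw [floodItems, blockRun_succ, h]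
    simp only [kernelProtocol]
    by_cases hx : N.graph.IsKept N.key t (Fintype.card W) x
    · simp only [hx, if_true]
      rw [if_neg]
      · rfl
      -- With a neighbour present, a kept node does receive a message.
      · obtain ⟨d, hd⟩ := Nat.exists_eq_succ_of_ne_zero (hdeg x)
        rw [List.flatten_eq_nil_iff]
        intro hall
        have := hall [0] (List.mem_ofFn.2 ⟨⟨0, by omega⟩, rfl⟩)
        simp at this
    · simp [hx]
  rw [h4]
  by_cases hx : N.graph.IsKept N.key t (Fintype.card W) x
  · unfold KernelData.ownItems
    rw [if_pos hx, Finset.mem_insert, Finset.mem_image]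
    have h5 : (N.blockRun (kernelProtocol H) t 2 x : KernelData).nbrs = N.nbrKeys x := by
      rw [blockRun_kernel_two]
    constructor
    · rintro (rfl | ⟨i, hi, rfl⟩)
      · exact ⟨x, hx, hx, Or.inl rfl, rfl⟩
      · rw [Finset.mem_filter, Finset.mem_range, h5, length_nbrKeys] at hi
        refine ⟨N.port x ⟨i, hi.1⟩, hx, (h3 ⟨i, hi.1⟩).1 hi.2, Or.inr (N.adj_port x _), ?_⟩
        rw [h5, ← nbrKeys_getD]
    · rintro ⟨y, -, hy, rfl | hxy, rfl⟩
      · exact Or.inl rfl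
      · obtain ⟨i, rfl⟩ := N.exists_port hxy
        refine Or.inr ⟨i, ?_, by rw [h5, nbrKeys_getD]⟩
        rw [Finset.mem_filter, Finset.mem_range, h5, length_nbrKeys]
        exact ⟨i.2, (h3 i).2 hy⟩
  · simp [hx]

/-- The part of a set of items that is sent in one block. -/
noncomputable def truncateItems (m : ℕ) (S : Finset ℕ) : Finset ℕ := (S.toList.take (m + 1)).toFinset

theorem truncateItems_subset (m : ℕ) (S : Finset ℕ) : truncateItems m S ⊆ S := fun a ha => by
  rw [truncateItems, List.mem_toFinset] at ha
  exact Finset.mem_toList.1 (List.mem_of_mem_take ha)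

theorem truncateItems_of_card_le {m : ℕ} {S : Finset ℕ} (h : S.card ≤ m) :
    truncateItems m S = S := by
  rw [truncateItems, List.take_of_length_le (by rw [Finset.length_toList]; omega),
    Finset.toList_toFinset]

theorem lt_card_truncateItems {m : ℕ} {S : Finset ℕ} (h : m < S.card) :
    m < (truncateItems m S).card := by
  rw [truncateItems, List.toFinset_card_of_nodup S.nodup_toList.take, List.length_take,
    Finset.length_toList]
  omega

theorem blockInbox_flood (s : ℕ) (x : V) (i : Fin (N.deg x)) :
    N.blockInbox (kernelProtocol H) t (s + 3) (N.blockRun (kernelProtocol H) t (s + 3)) x i =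
      (((N.floodItems H t s (N.port x i)).toList.take
        (itemBound (Fintype.card W) t + 1)).filter (· < N.idBound ^ 2)) := rfl

theorem mem_floodItems_succ_iff {s : ℕ} {x : V} {a : ℕ} :
    a ∈ N.floodItems H t (s + 1) x ↔ a ∈ N.floodItems H t s x ∨ ∃ y, N.graph.Adj x y ∧
      a ∈ truncateItems (itemBound (Fintype.card W) t) (N.floodItems H t s y) ∧
        a < N.idBound ^ 2 := by
  have h : N.floodItems H t (s + 1) x = N.floodItems H t s x ∪
      (List.ofFn (N.blockInbox (kernelProtocol H) t (s + 3)
        (N.blockRun (kernelProtocol H) t (s + 3)) x)).flatten.toFinset := rfl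
  rw [h, Finset.mem_union, List.mem_toFinset, List.mem_flatten]
  refine or_congr_right ?_
  simp only [List.mem_ofFn, truncateItems, List.mem_toFinset]
  constructor
  · rintro ⟨_, ⟨i, rfl⟩, ha⟩
    rw [blockInbox_flood, List.mem_filter] at ha
    exact ⟨_, N.adj_port x i, ha.1, by simpa using ha.2⟩
  · rintro ⟨y, hy, ha, hlt⟩
    obtain ⟨i, rfl⟩ := N.exists_port hy
    refine ⟨_, ⟨i, rfl⟩, ?_⟩
    rw [blockInbox_flood, List.mem_filter]
    exact ⟨ha, by simpa using hlt⟩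

variable {N}

/-- Shows that the encoding suppresses no item, which removes the size filter from the flooding
recursion. -/
theorem lt_of_mem_floodItems (hdeg : ∀ x, N.deg x ≠ 0) {s : ℕ} {x : V} {a : ℕ}
    (ha : a ∈ N.floodItems H t s x) : a < N.idBound ^ 2 := by
  induction s with
  | zero =>
    obtain ⟨y, -, -, -, rfl⟩ := (mem_floodItems_zero H t hdeg).1 ha
    exact N.pair_key_lt x y
  | succ s ih =>
    rcases (N.mem_floodItems_succ_iff H t).1 ha with h | ⟨y, -, -, h⟩
    · exact ih h
    · exact h

theorem mem_floodItems_succ (hdeg : ∀ x, N.deg x ≠ 0) (s : ℕ) (x : V) (a : ℕ) :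
    a ∈ N.floodItems H t (s + 1) x ↔ a ∈ N.floodItems H t s x ∨ ∃ y, N.graph.Adj x y ∧
      a ∈ truncateItems (itemBound (Fintype.card W) t) (N.floodItems H t s y) := by
  rw [mem_floodItems_succ_iff]
  refine or_congr_right (exists_congr fun y => and_congr_right fun _ => and_iff_left_of_imp ?_)
  exact fun h => lt_of_mem_floodItems H t hdeg (truncateItems_subset _ _ h)

/-- At the end of phase `t`, either all nodes know the kernel, which is small, or all nodes know that
it is not small. -/
theorem exists_kernel [Finite V] (hG : N.graph.Connected) (hdeg : ∀ x, N.deg x ≠ 0) :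
    ∃ U, N.IsKernel t (Fintype.card W) U ∧ ∀ x,
      (kernelProtocol H).result t (N.info x)
        (N.blockRun (kernelProtocol H) t ((kernelProtocol H).blocks t) x) =
      if U.card ≤ itemBound (Fintype.card W) t then some (kernelAnswer H U (N.key x)) else none := by
  classical
  have := Fintype.ofFinite V
  let U : Finset ℕ := Finset.univ.biUnion fun x => N.floodItems H t 0 x
  have hU : ∀ a, a ∈ U ↔ ∃ x, a ∈ N.floodItems H t 0 x := fun a => by simp [U]
  refine ⟨U, fun a => ?_, fun x => ?_⟩
  · simp only [hU, mem_floodItems_zero H t hdeg]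
  · have hc := hG.flood_complete (m := itemBound (Fintype.card W) t)
      (f := truncateItems (itemBound (Fintype.card W) t)) (I := N.floodItems H t)
      (truncateItems_subset _) (fun S => truncateItems_of_card_le) (fun S => lt_card_truncateItems)
      (mem_floodItems_succ H t hdeg) hU (key := N.key) (t := t) (q := Fintype.card W)
      (item := fun z => Nat.pair (N.key z) (N.key z))
      (fun a b h => N.key_injective (Nat.pair_eq_pair.1 h).1)
      (fun z hz => (mem_floodItems_zero H t hdeg).2 ⟨z, hz, hz, Or.inl rfl, rfl⟩) x
    -- The number of blocks, `itemBound + 4`, is `(itemBound + 1) + 3`.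
    change (if (N.floodItems H t (itemBound (Fintype.card W) t + 1) x).card ≤ _ then
      some (kernelAnswer H (N.floodItems H t (itemBound (Fintype.card W) t + 1) x) (N.key x))
      else none) = _
    by_cases h : U.card ≤ itemBound (Fintype.card W) t
    · rw [if_pos (hc.1.2 h), if_pos h, hc.2 h]
    · rw [if_neg (mt hc.1.1 h), if_neg h]

end CongestNetwork

/-! ### Round count, bandwidth and conclusion. -/

namespace CongestNetwork

open SimpleGraph

variable {V : Type v} {W : Type u} {N : CongestNetwork V}

theorem subsingleton_of_deg_eq_zero (hG : N.graph.Connected) {x : V} (hx : N.deg x = 0) :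
    Subsingleton V := by
  have : ∀ y, x = y := fun y => by
    by_contra hne
    have hpos := hG.pos_dist_of_ne hne
    obtain ⟨w, hw⟩ := hG.exists_dist_eq (x := x) (v := y) (d := 1) hpos
    obtain ⟨i, -⟩ := N.exists_port (dist_eq_one_iff_adj.1 hw)
    exact absurd i.2 (by omega)
  exact ⟨fun a b => (this a).symm.trans (this b)⟩

theorem isKernel_singleton [Subsingleton V] (x : V) (t q : ℕ) :
    N.IsKernel t q {Nat.pair (N.key x) (N.key x)} := fun a => by
  have hx : N.graph.IsKept N.key t q x := by
    obtain ⟨z, hz, -⟩ := N.graph.exists_isKept_twin N.key t q x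
    rwa [Subsingleton.elim x z]
  rw [Finset.mem_singleton]
  constructor
  · rintro rfl
    exact ⟨x, x, hx, hx, Or.inl rfl, rfl⟩
  · rintro ⟨y, z, -, -, -, rfl⟩
    rw [Subsingleton.elim y x, Subsingleton.elim z x]

/-- Each phase takes at most `2 ^ (4 * (t + q) + 6)` rounds and there are at most `2 ^ (t + q)`
phases, so even a linear exponent suffices. -/
theorem sum_rounds_le {s t q : ℕ} (hst : s ≤ t) (ht : 0 < t) :
    ∑ r ∈ Finset.range (s + 1), (itemBound q r + 4) * (itemBound q r + 1) ≤
      2 ^ (12 * (t + q) ^ 2) := by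
  have hbase : t + 2 ^ t * (q + 1) ≤ 2 ^ (t + q + 1) := by
    have h1 : t < 2 ^ t := Nat.lt_two_pow_self
    have h2 : q + 1 < 2 ^ (q + 1) := Nat.lt_two_pow_self
    calc t + 2 ^ t * (q + 1) ≤ 2 ^ t * (q + 1 + 1) := by nlinarith
      _ ≤ 2 ^ t * 2 ^ (q + 1) := Nat.mul_le_mul_left _ h2
      _ = _ := by rw [← pow_add, Nat.add_assoc]
  have hm : itemBound q t ≤ 2 ^ (2 * (t + q) + 2) := by
    refine (Nat.pow_le_pow_left hbase 2).trans_eq ?_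
    rw [← pow_mul]
    ring_nf
  have hmono : ∀ r ≤ t, itemBound q r ≤ itemBound q t := fun r hr =>
    Nat.pow_le_pow_left (Nat.add_le_add hr
      (Nat.mul_le_mul_right _ (Nat.pow_le_pow_right (by norm_num) hr))) 2
  have h4 : 4 ≤ 2 ^ (2 * (t + q) + 2) :=
    (show 4 = 2 ^ 2 from rfl) ▸ Nat.pow_le_pow_right (by norm_num) (by omega)
  have hs : s + 1 ≤ 2 ^ (t + q) :=
    (show s + 1 ≤ t + q + 1 by omega).trans Nat.lt_two_pow_self
  have hB : ∀ r ≤ t, itemBound q r + 4 ≤ 2 ^ (2 * (t + q) + 3) := fun r hr => by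
    have := hmono r hr
    rw [pow_succ]
    omega
  calc _ ≤ ∑ r ∈ Finset.range (s + 1), 2 ^ (2 * (t + q) + 3) * 2 ^ (2 * (t + q) + 3) := by
        refine Finset.sum_le_sum fun r hr => ?_
        have hr' := hB r (by rw [Finset.mem_range] at hr; omega)
        exact Nat.mul_le_mul hr' (by omega)
    _ = (s + 1) * 2 ^ (4 * (t + q) + 6) := by
        rw [Finset.sum_const, Finset.card_range, smul_eq_mul, ← pow_add]
        ring_nf
    _ ≤ 2 ^ (t + q) * 2 ^ (4 * (t + q) + 6) := Nat.mul_le_mul_right _ hs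
    _ = 2 ^ (5 * (t + q) + 6) := by rw [← pow_add]; ring_nf
    -- Since `t + q ≥ 1`, the constant 12 covers `5 + 6`.
    _ ≤ 2 ^ (12 * (t + q) ^ 2) := Nat.pow_le_pow_right (by norm_num) (by nlinarith)

theorem sq_idBound_lt {n c : ℕ} (hn : 1 < n) (h : N.idBound ≤ n ^ c) :
    N.idBound ^ 2 < 2 ^ ((2 * c + 1) * Nat.clog 2 n) := by
  have hL : 0 < Nat.clog 2 n := Nat.clog_pos one_lt_two hn
  calc N.idBound ^ 2 ≤ ((2 ^ Nat.clog 2 n) ^ c) ^ 2 :=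
        Nat.pow_le_pow_left (h.trans (Nat.pow_le_pow_left (Nat.le_pow_clog one_lt_two n) c)) 2
    _ = 2 ^ (2 * c * Nat.clog 2 n) := by rw [← pow_mul, ← pow_mul]; ring_nf
    _ < _ := Nat.pow_lt_pow_right one_lt_two (by rw [Nat.add_mul]; omega)

/-- The nodes halt in the first phase with a small kernel. Phase `τ` has one, so this phase is at
most `τ`; an edge exists, so `τ > 0`. -/
theorem exists_haltsWith_kernelProtocol [Finite V] [Fintype W] (H : SimpleGraph W)
    (hG : N.graph.Connected) (hdeg : ∀ x, N.deg x ≠ 0) :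
    ∃ (T : ℕ) (out : V → DetectionAnswer W),
      T ≤ 2 ^ (12 * (N.graph.vertexCoverNum.toNat + Fintype.card W) ^ 2) ∧
      N.HaltsWith (kernelProtocol H).toCongest T out ∧ IsInducedDetection N.graph H out := by
  classical
  choose U hU hres using fun t => exists_kernel H t hG hdeg
  obtain ⟨X, hX, hcov⟩ := N.graph.vertexCoverNum_exists
  have hcard : X.ncard = N.graph.vertexCoverNum.toNat := by rw [Set.ncard_def, hX]
  have hpos : 0 < N.graph.vertexCoverNum.toNat := by
    obtain ⟨x⟩ := hG.nonempty
    have hadj := N.adj_port x ⟨0, Nat.pos_of_ne_zero (hdeg x)⟩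
    rw [← hcard, Set.ncard_pos]
    exact (hcov hadj).elim (fun h => ⟨_, h⟩) fun h => ⟨_, h⟩
  have hex : ∃ t, (U t).card ≤ itemBound (Fintype.card W) t :=
    ⟨_, (hU _).card_le hcov hcard.le⟩
  refine ⟨_, fun x => kernelAnswer H (U (Nat.find hex)) (N.key x), ?_,
    N.haltsWith_of_result (kernelProtocol H) (fun x => ?_) (Nat.find hex) _ (fun s hs x => ?_)
      fun x => ?_, (hU _).isInducedDetection H le_rfl⟩
  · exact sum_rounds_le (Nat.find_min' hex ((hU _).card_le hcov hcard.le)) hpos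
  · exact if_neg (hdeg x)
  · rw [hres, if_neg (Nat.find_min hex hs)]
  · rw [hres, if_pos (Nat.find_spec hex)]

end CongestNetwork

theorem mainTheorem10 :
    ∃ C : ℕ, ∀ c : ℕ, ∃ b : ℕ,
      ∀ (W : Type u) [Fintype W] (H : SimpleGraph W),
        ∃ A : CongestAlgorithm (DetectionAnswer W),
          ∀ (V : Type v) [Fintype V] (N : CongestNetwork V),
            N.graph.Connected → N.idBound ≤ Fintype.card V ^ c →
              N.RespectsBandwidth A (b * Nat.clog 2 (Fintype.card V)) ∧
              ∃ (T : ℕ) (out : V → DetectionAnswer W),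
                T ≤ 2 ^ (C * (N.graph.vertexCoverNum.toNat + Fintype.card W) ^ 2) ∧
                N.HaltsWith A T out ∧ IsInducedDetection N.graph H out := by
  refine ⟨12, fun c => ⟨2 * c + 1, fun W _ H => ⟨(kernelProtocol H).toCongest,
    fun V _ N hG hN => ?_⟩⟩⟩
  by_cases hdeg : ∀ x, N.deg x ≠ 0
  · refine ⟨N.respectsBandwidth_toCongest _ (CongestNetwork.sq_idBound_lt ?_ hN),
      CongestNetwork.exists_haltsWith_kernelProtocol H hG hdeg⟩
    obtain ⟨x⟩ := hG.nonempty
    exact Fintype.one_lt_card_iff.2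
      ⟨x, _, (N.adj_port x ⟨0, Nat.pos_of_ne_zero (hdeg x)⟩).ne⟩
  -- A node of degree 0 is the whole graph. The bandwidth is then 0, and the node answers in round
  -- 0.
  · push Not at hdeg
    obtain ⟨x, hx⟩ := hdeg
    have := CongestNetwork.subsingleton_of_deg_eq_zero hG hx
    have hall : ∀ y, N.deg y = 0 := fun y => Subsingleton.elim x y ▸ hx
    refine ⟨fun T y i => absurd i.2 (by have := hall y; omega), 0, _, Nat.zero_le _,
      N.haltsWith_of_early (kernelProtocol H)
        (fun y => kernelAnswer H {Nat.pair (N.key x) (N.key x)} (N.key y)) (fun y => ?_),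
      (CongestNetwork.isKernel_singleton x 0 (Fintype.card W)).isInducedDetection H le_rfl⟩
    rw [← Subsingleton.elim x y]
    exact if_pos hx
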